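/- Let $K\ge 1$, let $X$ be a random vector in $\mathbb{R}^d$, let $c_1,\dots,c_K:\mathbb{R}^d\to\mathbb{R}$ be known measurable cost functions with $\mathbb{E}|c_k(X)|<\infty$, and let $p=(p_1,\dots,p_K)$ be a probability vector. Let $g^*\in\mathbb{R}^K$ be a solution of the Kantorovich dual problem $$\sup_{g\in\mathbb{R}^K}\ \mathbb{E}\Big(\min_{1\le j\le K}\big(c_j(X)-g_j\big)\Big)+p^\top g ,$$ and put $Z_{j,k}=(c_j(X)-g^*_j)-(c_k(X)-g^*_k)$. Suppose that there are constants $\kappa_1,\kappa_2,\kappa_5>0$, $\kappa_4\ge 0$ and $\kappa_3,\kappa_6\in\mathbb{R}$ such that, for all $j\ne k$ in $\{1,\dots,K\}$: (1) the law of $c_j(X)-c_k(X)$ is absolutely continuous with respect to Lebesgue measure; (2.i) $Z_{j,k}$ has a density with values in $[\kappa_2,\kappa_3]$ on $[-\kappa_1,\kappa_1]$; (2.ii) $P\big(\min_{\ell\notin\{j,k\}} Z_{\ell,k}\ge\kappa_4 \,\big|\, 0<Z_{j,k}\le\kappa\big)\ge\kappa_5$ for every $0<\kappa<\kappa_1$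 (a minimum over no index is $+\infty$); (2.iii) $\|X\|_2\le\kappa_6$ almost surely. Let $X^1,X^2,\dots$ be i.i.d. copies of $X$, let $g^0\in\mathbb{R}^K$ be deterministic, let $\alpha>0$, and let $$g^{n+1}=g^n+\frac{\alpha}{n+1}\,(p-\zeta^{n+1}),\qquad \zeta^{n+1}_k=\mathbf 1\Big\{c_k(X^{n+1})-g^n_k=\min_j \big(c_j(X^{n+1})-g^n_j\big)\Big\},\quad k=1,\dots,K .$$ Then there is $\bar\alpha>0$, depending only on $\kappa_1,\kappa_2,\kappa_5$, such that for every $\alpha>\bar\alpha$ there is a constant $D$, not depending on $n$, with $$\mathbb{E}\,\big\|(g^n-g^n_1\mathbf 1)-(g^*-g^*_1\mathbf 1)\big\|_2^2\le\frac Dn\qquad\text{for all } n\ge 1,$$ where $\mathbf 1=(1,\dots,1)^\top$; and if $g^*$ is the dual solution with $\sum_k g^*_k=\sum_k g^0_k$ (dual solutions are determined only up to adding a multiple of $\mathbf 1$), then also $$\mathbb{E}\,\|g^n-g^*\|_2^2\le\frac Dn\qquad\text{for all } n\ge 1 .$$ -/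

import Mathlib

open MeasureTheory ProbabilityTheory

/-- `F(g, x) = min_j (c_j(x) - g_j)`. -/
noncomputable def reducedCost {d K : ℕ} [NeZero K]
    (c : Fin K → EuclideanSpace ℝ (Fin d) → ℝ) (g : Fin K → ℝ)
    (x : EuclideanSpace ℝ (Fin d)) : ℝ :=
  Finset.univ.inf' Finset.univ_nonempty (fun j => c j x - g j)

/-- The Kantorovich dual objective `g ↦ E[F(g, X)] + pᵀ g`, where `X` has law `μ`. -/
noncomputable def dualObjective {d K : ℕ} [NeZero K]
    (μ : Measure (EuclideanSpace ℝ (Fin d)))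
    (c : Fin K → EuclideanSpace ℝ (Fin d) → ℝ) (p : Fin K → ℝ) (g : Fin K → ℝ) : ℝ :=
  (∫ x, reducedCost c g x ∂μ) + ∑ k, p k * g k

/-- `g*` solves the dual problem: it maximizes the dual objective over `ℝ^K`. -/
def IsDualOptimal {d K : ℕ} [NeZero K]
    (μ : Measure (EuclideanSpace ℝ (Fin d)))
    (c : Fin K → EuclideanSpace ℝ (Fin d) → ℝ) (p : Fin K → ℝ) (gstar : Fin K → ℝ) : Prop :=
  ∀ g : Fin K → ℝ, dualObjective μ c p g ≤ dualObjective μ c p gstar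

/-- The margin `Z_{j,k} = (c_j(X) - g*_j) - (c_k(X) - g*_k)` as a function of the value of `X`. -/
def margin {d K : ℕ} (c : Fin K → EuclideanSpace ℝ (Fin d) → ℝ) (gstar : Fin K → ℝ)
    (j k : Fin K) (x : EuclideanSpace ℝ (Fin d)) : ℝ :=
  (c j x - gstar j) - (c k x - gstar k)

/-- For `j ≠ k`, the law of `c_j(X) - c_k(X)` is absolutely continuous with respect to Lebesgue
measure. -/
def CostDifferencesAC {d K : ℕ} (μ : Measure (EuclideanSpace ℝ (Fin d)))
    (c : Fin K → EuclideanSpace ℝ (Fin d) → ℝ) : Prop :=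
  ∀ j k : Fin K, j ≠ k → μ.map (fun x => c j x - c k x) ≪ (volume : Measure ℝ)

/-- The richness (margin) conditions on the law `μ` of `X`, with constants `κ₁, …, κ₆`. -/
structure RichDistribution {d K : ℕ} (μ : Measure (EuclideanSpace ℝ (Fin d)))
    (c : Fin K → EuclideanSpace ℝ (Fin d) → ℝ) (gstar : Fin K → ℝ)
    (κ₁ κ₂ κ₃ κ₄ κ₅ κ₆ : ℝ) : Prop where
  /-- For `j ≠ k`, `Z_{j,k}` has a density with values in `[κ₂, κ₃]` on `[-κ₁, κ₁]`. -/
  density : ∀ j k : Fin K, j ≠ k → ∃ f : ℝ → ENNReal, Measurable f ∧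
    μ.map (margin c gstar j k) = (volume : Measure ℝ).withDensity f ∧
    ∀ z ∈ Set.Icc (-κ₁) κ₁, ENNReal.ofReal κ₂ ≤ f z ∧ f z ≤ ENNReal.ofReal κ₃
  /-- `P(min_ℓ Z_{ℓ,k} ≥ κ₄ ∣ 0 < Z_{j,k} ≤ κ) ≥ κ₅` for `0 < κ < κ₁` and `j ≠ k`. The minimum is
  over the indices `ℓ` other than `j` and `k` (note that `Z_{k,k} = 0`); over no index it is
  `+∞`. -/
  separation : ∀ j k : Fin K, j ≠ k → ∀ κ : ℝ, 0 < κ → κ < κ₁ →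
    ENNReal.ofReal κ₅ ≤
      (ProbabilityTheory.cond μ {x | 0 < margin c gstar j k x ∧ margin c gstar j k x ≤ κ})
        {x | ∀ l : Fin K, l ≠ j → l ≠ k → κ₄ ≤ margin c gstar l k x}
  /-- `X` is bounded. -/
  bounded : ∀ᵐ x ∂μ, ‖x‖ ≤ κ₆

open Classical in
/-- The stochastic gradient `ζ`: its `k`-th entry is the indicator of `k` attaining
`min_j (c_j(x) - g_j)`. -/
noncomputable def selectionIndicator {d K : ℕ}
    (c : Fin K → EuclideanSpace ℝ (Fin d) → ℝ) (g : Fin K → ℝ)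
    (x : EuclideanSpace ℝ (Fin d)) (k : Fin K) : ℝ :=
  if ∀ j : Fin K, c k x - g k ≤ c j x - g j then 1 else 0

/-- The stochastic approximation iterates `g^{n+1} = g^n + α / (n+1) (p - ζ^{n+1})` started at
`g^0 = g0`, along a sequence of observations in which `x n` is the `(n+1)`-st one, `X^{n+1}`. -/
noncomputable def saIterate {d K : ℕ}
    (c : Fin K → EuclideanSpace ℝ (Fin d) → ℝ) (p : Fin K → ℝ) (α : ℝ) (g0 : Fin K → ℝ)
    (x : ℕ → EuclideanSpace ℝ (Fin d)) : ℕ → Fin K → ℝ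
  | 0 => g0
  | n + 1 => fun k => saIterate c p α g0 x n k +
      α / ((n : ℝ) + 1) * (p k - selectionIndicator c (saIterate c p α g0 x n) (x n) k)

/-- The representative, among the vectors that differ from `g` by a constant vector, whose first
entry is zero. -/
def normalizeFirst {K : ℕ} [NeZero K] (g : Fin K → ℝ) : Fin K → ℝ :=
  fun k => g k - g 0

/-- The squared Euclidean distance `‖g - h‖₂²` on `ℝ^K`. -/
def sqDist {K : ℕ} (g h : Fin K → ℝ) : ℝ :=
  ∑ k, (g k - h k) ^ 2

/-! Write w = g - g*, translating g* so that ∑ w_k = 0; the iteration preserves this, since ties are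
null and so ζ and p both sum to 1. The Lyapunov function is V(g) = ∑ exp(w_k/κ₁) - K. A quadratic
one would not do: its drift grows only linearly in w. For V the drift is proportional to V itself
far away and is quadratic near 0, like V, so no a priori bound on the iterates is needed.

The drift comes from a coupling. For the same x let σ be the index selected under g and τ the one
under g*. Adding the two minimality inequalities gives w_σ ≥ w_τ, so E φ(w_σ) ≥ E φ(w_τ) for
monotone φ. The gain is quantitative on the event that k is optimal under g* and j is worse by at
most κ: there τ = k and w_σ ≥ w_j - κ. This event has probability at least βκ with β = κ₂κ₅. Taking
j, k to be the argmax and argmin of w gives `drift_lower_bound`, up to a factor K. Since every index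
is selected under g* with probability at least βκ₁/2, K ≤ 2/(βκ₁), which removes K from the rate
(`mul_sum_exp_sub_card_le_drift`).

First-order optimality identifies p with the selection probabilities at g*. Hence E V(g^n) satisfies
a recursion with contraction aα/(n+1), a = κ₁β²/72, and O(1/n²) noise; aα > 1 gives the rate 1/n,
and V dominates the squared norm. -/

/-! ### Real inequalities: the recursion and the exponential Lyapunov function. -/

lemma exp_le_one_add_add_sq_mul_exp_abs (u : ℝ) :
    Real.exp u ≤ 1 + u + u ^ 2 * Real.exp |u| := by
  have h1 : Real.exp u - 1 ≤ u * Real.exp u := by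
    have h := Real.add_one_le_exp (-u)
    have h2 : Real.exp u * Real.exp (-u) = 1 := by rw [← Real.exp_add]; simp
    nlinarith [Real.exp_pos u]
  have h0 := Real.add_one_le_exp u
  rcases le_total 0 u with hu | hu
  · rw [abs_of_nonneg hu]
    nlinarith [Real.exp_pos u]
  · have h3 : 1 ≤ Real.exp |u| := Real.one_le_exp (abs_nonneg u)
    nlinarith [sq_nonneg u]

/-- The `1 / n` rate for a stochastic approximation recursion with step sizes of order `1 / n`. -/
lemma exists_le_div_of_recursion {E : ℕ → ℝ} {b C₁ C₂ : ℝ} (hb : 1 < b) (hC₁ : 0 ≤ C₁)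
    (hC₂ : 0 ≤ C₂)
    (h : ∀ n : ℕ, E (n + 1) ≤
      (1 - b / ((n : ℝ) + 1) + C₁ / ((n : ℝ) + 1) ^ 2) * E n + C₂ / ((n : ℝ) + 1) ^ 2) :
    ∃ D : ℝ, ∀ n : ℕ, 1 ≤ n → E n ≤ D / n := by
  obtain ⟨N, hN⟩ := exists_nat_ge (2 * C₁ / (b - 1) + b + 1)
  have hb1 : 0 < b - 1 := by linarith
  have hq : 0 ≤ 2 * C₁ / (b - 1) := by positivity
  -- The sum covers the indices up to `N`. The other term drives the induction: half of D(b - 1)m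
  -- absorbs C₂m, and the choice of `N` lets the other half absorb C₁D.
  set D : ℝ := 2 * C₂ / (b - 1) + ∑ n ∈ Finset.range (N + 1), n * |E n| with hD
  have hsum : 0 ≤ ∑ n ∈ Finset.range (N + 1), (n : ℝ) * |E n| :=
    Finset.sum_nonneg fun i _ => by positivity
  have hD2 : 2 * C₂ / (b - 1) ≤ D := by linarith
  have hD0 : 0 ≤ D := le_trans (by positivity) hD2
  have hDb : 2 * C₂ ≤ D * (b - 1) := by rwa [div_le_iff₀ hb1] at hD2
  refine ⟨D, fun n hn => ?_⟩
  rcases le_or_gt n N with hnN | hnN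
  · have hnpos : (0 : ℝ) < n := by exact_mod_cast hn
    rw [le_div_iff₀ hnpos]
    have h1 : (n : ℝ) * |E n| ≤ ∑ n ∈ Finset.range (N + 1), (n : ℝ) * |E n| :=
      Finset.single_le_sum (f := fun n : ℕ => (n : ℝ) * |E n|) (fun i _ => by positivity)
        (Finset.mem_range.2 (Nat.lt_succ_of_le hnN))
    have h2 : 0 ≤ 2 * C₂ / (b - 1) := by positivity
    nlinarith [le_abs_self (E n)]
  · have hN1 : 1 ≤ N := by
      have : (1 : ℝ) ≤ N := by linarith
      exact_mod_cast this
    have key : ∀ m : ℕ, N ≤ m → E m ≤ D / m := by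
      intro m hm
      induction m, hm using Nat.le_induction with
      | base =>
        have hnpos : (0 : ℝ) < N := by exact_mod_cast hN1
        rw [le_div_iff₀ hnpos]
        have h1 : (N : ℝ) * |E N| ≤ ∑ n ∈ Finset.range (N + 1), (n : ℝ) * |E n| :=
          Finset.single_le_sum (f := fun n : ℕ => (n : ℝ) * |E n|) (fun i _ => by positivity)
            (Finset.mem_range.2 (Nat.lt_succ_self N))
        have h2 : 0 ≤ 2 * C₂ / (b - 1) := by positivity
        nlinarith [le_abs_self (E N)]
      | succ m hm ih =>
        have hmN : (N : ℝ) ≤ m := by exact_mod_cast hm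
        have hmpos : (0 : ℝ) < m := by
          have : 0 < m := by omega
          exact_mod_cast this
        have hC : 2 * C₁ ≤ (b - 1) * m := by
          have : 2 * C₁ / (b - 1) ≤ m := by linarith
          rw [div_le_iff₀ hb1] at this
          linarith
        have hcoef : 0 ≤ 1 - b / ((m : ℝ) + 1) + C₁ / ((m : ℝ) + 1) ^ 2 := by
          have h1 : b / ((m : ℝ) + 1) ≤ 1 := by
            rw [div_le_one (by positivity)]; linarith
          have h2 : 0 ≤ C₁ / ((m : ℝ) + 1) ^ 2 := by positivity
          linarith
        refine (h m).trans ?_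
        refine (add_le_add_left (mul_le_mul_of_nonneg_left ih hcoef) _).trans ?_
        push_cast
        have e : D / ((m : ℝ) + 1) - ((1 - b / ((m : ℝ) + 1) + C₁ / ((m : ℝ) + 1) ^ 2) * (D / m)
            + C₂ / ((m : ℝ) + 1) ^ 2) =
            (D * (b - 1) * (m + 1) - C₁ * D - C₂ * m) / (m * ((m : ℝ) + 1) ^ 2) := by
          field_simp
          ring
        have : 0 ≤ (D * (b - 1) * (m + 1) - C₁ * D - C₂ * m) / (m * ((m : ℝ) + 1) ^ 2) := by
          apply div_nonneg _ (by positivity)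
          nlinarith [mul_nonneg hD0 hb1.le, mul_le_mul_of_nonneg_left hC hD0,
            mul_le_mul_of_nonneg_right hDb hmpos.le]
        linarith
    exact key n hnN.le

/-- For a vector with zero sum the excess of an exponential sum is quadratically small in the
diameter. -/
lemma sum_exp_sub_card_le {K : ℕ} {s R : ℝ} (hs : 0 ≤ s) (w : Fin K → ℝ) (hw : ∑ k, w k = 0)
    (hR : ∀ k, |w k| ≤ R) :
    ∑ k, Real.exp (s * w k) - K ≤ K * ((s * R) ^ 2 * Real.exp (s * R)) := by
  have h : ∀ k, Real.exp (s * w k) - 1 - s * w k ≤ (s * R) ^ 2 * Real.exp (s * R) := by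
    intro k
    have h1 := exp_le_one_add_add_sq_mul_exp_abs (s * w k)
    have h2 : |s * w k| ≤ s * R := by
      rw [abs_mul, abs_of_nonneg hs]; exact mul_le_mul_of_nonneg_left (hR k) hs
    have h3 : (s * w k) ^ 2 ≤ (s * R) ^ 2 := by
      rw [← sq_abs]; exact pow_le_pow_left₀ (abs_nonneg _) h2 2
    have h4 : (s * w k) ^ 2 * Real.exp |s * w k| ≤ (s * R) ^ 2 * Real.exp (s * R) :=
      mul_le_mul h3 (Real.exp_le_exp.2 h2) (Real.exp_pos _).le (sq_nonneg _)
    linarith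
  have h5 := Finset.sum_le_sum fun k (_ : k ∈ Finset.univ) => h k
  simp only [Finset.sum_sub_distrib, ← Finset.mul_sum, hw, Finset.sum_const, Finset.card_univ,
    Fintype.card_fin, nsmul_eq_mul] at h5
  linarith

/-- The zero sum allows the linear terms to be subtracted for free, after which every summand is
nonnegative and one may be kept. -/
lemma le_sum_exp_sub_card {K : ℕ} {s : ℝ} (w : Fin K → ℝ) (hw : ∑ k, w k = 0) (j : Fin K) :
    Real.exp (s * w j) - 1 - s * w j ≤ ∑ k, Real.exp (s * w k) - K := by
  have h : ∀ k ∈ Finset.univ, 0 ≤ Real.exp (s * w k) - 1 - s * w k := by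
    intro k _
    have := Real.add_one_le_exp (s * w k)
    linarith
  have h5 := Finset.single_le_sum h (Finset.mem_univ j)
  simp only [Finset.sum_sub_distrib, ← Finset.mul_sum, hw, Finset.sum_const, Finset.card_univ,
    Fintype.card_fin, nsmul_eq_mul] at h5
  linarith

/-- For a vector with zero sum the exponential excess dominates the squared norm. -/
lemma sum_sq_le_sum_exp_sub_card {K : ℕ} {s : ℝ} (hs : 0 < s) (w : Fin K → ℝ)
    (hw : ∑ k, w k = 0) :
    ∑ k, w k ^ 2 ≤ K ^ 3 * (2 / s ^ 2) * (∑ k, Real.exp (s * w k) - K) := by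
  rcases K.eq_zero_or_pos with rfl | hK
  · simp
  have : NeZero K := ⟨hK.ne'⟩
  obtain ⟨j, -, hj⟩ := Finset.exists_max_image Finset.univ w Finset.univ_nonempty
  have hK1 : (1 : ℝ) ≤ K := by exact_mod_cast hK
  have hsum : ∀ k, 0 ≤ w j - w k := fun k => sub_nonneg.2 (hj k (Finset.mem_univ k))
  have htot : ∑ k, (w j - w k) = K * w j := by
    simp [Finset.sum_sub_distrib, hw]
  -- The maximal entry controls all others, also the negative ones, because the nonnegative gaps to
  -- it add up to K w_j.
  have hle : ∀ k, w j - w k ≤ K * w j := fun k => by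
    rw [← htot]
    exact Finset.single_le_sum (f := fun k => w j - w k) (fun i _ => hsum i) (Finset.mem_univ k)
  have hj0 : 0 ≤ w j := by
    have := (hsum j).trans (hle j)
    nlinarith
  have hk : ∀ k, w k ^ 2 ≤ (K * w j) ^ 2 := by
    intro k
    apply sq_le_sq'
    · linarith [hle k]
    · nlinarith [hsum k]
  have h1 : (s * w j) ^ 2 / 2 ≤ ∑ k, Real.exp (s * w k) - K := by
    have h2 := Real.quadratic_le_exp_of_nonneg (mul_nonneg hs.le hj0)
    linarith [le_sum_exp_sub_card (s := s) w hw j]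
  calc ∑ k, w k ^ 2 ≤ ∑ _k : Fin K, (K * w j) ^ 2 := Finset.sum_le_sum fun k _ => hk k
    _ = K ^ 3 * (2 / s ^ 2) * ((s * w j) ^ 2 / 2) := by
        simp only [Finset.sum_const, Finset.card_univ, Fintype.card_fin, nsmul_eq_mul]
        field_simp
    _ ≤ _ := mul_le_mul_of_nonneg_left h1 (by positivity)

/-- With R the spread of w and x = R/κ₁, both sides are of order x² when x ≤ 1, and both are of
order exp(w_j/κ₁) when x ≥ 1. The exponent scale 1/κ₁ makes the two regimes meet at x = 1. The
constant 36 comes from the first: 4 from the two halves of x, and 9 from exp(2x) ≤ 9. -/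
lemma drift_lower_bound {K : ℕ} {κ₁ β : ℝ} (hκ₁ : 0 < κ₁) (hβ : 0 ≤ β) (w : Fin K → ℝ)
    (hw : ∑ i, w i = 0) {j k : Fin K} (hj : ∀ i, w i ≤ w j) (hk : ∀ i, w k ≤ w i) :
    β / 36 * (∑ i, Real.exp (1 / κ₁ * w i) - K) ≤
      K * (1 / κ₁ * (β * (min (w j - w k) κ₁ / 2) *
        (Real.exp (1 / κ₁ * (w j - min (w j - w k) κ₁ / 2)) - Real.exp (1 / κ₁ * w k)))) := by
  have hj0 : 0 ≤ w j := by
    by_contra! h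
    have := Finset.sum_lt_sum_of_nonempty (s := Finset.univ) (f := w) (g := fun _ => 0)
      ⟨j, Finset.mem_univ j⟩ (fun i _ => (hj i).trans_lt h)
    simp [hw] at this
  have hk0 : w k ≤ 0 := by
    by_contra! h
    have := Finset.sum_lt_sum_of_nonempty (s := Finset.univ) (g := w) (f := fun _ => 0)
      ⟨j, Finset.mem_univ j⟩ (fun i _ => h.trans_le (hk i))
    simp [hw] at this
  have hs : 0 < 1 / κ₁ := by positivity
  set s := 1 / κ₁ with hs_def
  have hsκ : s * κ₁ = 1 := by rw [hs_def]; field_simp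
  set R := w j - w k with hR
  have hR0 : 0 ≤ R := by linarith
  have he : Real.exp 1 ≤ 3 := by linarith [Real.exp_one_lt_d9]
  have hK0 : (0 : ℝ) ≤ K := Nat.cast_nonneg K
  rcases le_total R κ₁ with hRκ | hRκ
  · rw [min_eq_left hRκ]
    have h1 := sum_exp_sub_card_le hs.le w hw (R := R) (fun i => by
      rw [abs_le]; constructor <;> linarith [hj i, hk i])
    have hx0 : 0 ≤ s * R := by positivity
    have hx1 : s * R ≤ 1 := by rw [← hsκ]; exact mul_le_mul_of_nonneg_left hRκ hs.le
    have e1 : s * (w j - R / 2) = s * w k + s * R / 2 := by rw [hR]; ring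
    rw [e1, Real.exp_add]
    generalize hx : s * R = x at *
    have hkx : -x ≤ s * w k := by
      rw [← hx]; nlinarith
    have h2 : x / 2 ≤ Real.exp (x / 2) - 1 := by linarith [Real.add_one_le_exp (x / 2)]
    have h3 : Real.exp (-x) ≤ Real.exp (s * w k) := Real.exp_le_exp.2 hkx
    have h4 : Real.exp x ≤ 9 * Real.exp (-x) := by
      have hx3 : Real.exp x ≤ 3 := (Real.exp_le_exp.2 hx1).trans he
      have : Real.exp x * Real.exp (-x) = 1 := by rw [← Real.exp_add]; simp
      have h0 := Real.exp_pos x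
      have h0' := Real.exp_pos (-x)
      nlinarith [mul_le_mul hx3 hx3 h0.le (by norm_num)]
    have h5 : Real.exp (-x) * (x / 2) ≤ Real.exp (s * w k) * (Real.exp (x / 2) - 1) :=
      mul_le_mul h3 h2 (by positivity) (Real.exp_pos _).le
    calc β / 36 * (∑ i, Real.exp (s * w i) - K)
        ≤ β / 36 * (K * (x ^ 2 * (9 * Real.exp (-x)))) := by
          refine mul_le_mul_of_nonneg_left (h1.trans ?_) (by positivity)
          gcongr
      _ = K * β * (x / 2) * (Real.exp (-x) * (x / 2)) := by ring
      _ ≤ K * β * (x / 2) * (Real.exp (s * w k) * (Real.exp (x / 2) - 1)) := by gcongr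
      _ = _ := by rw [← hx]; ring
  · rw [min_eq_right hRκ]
    have h1 : ∑ i, Real.exp (s * w i) ≤ K * Real.exp (s * w j) := by
      calc ∑ i, Real.exp (s * w i) ≤ ∑ _i : Fin K, Real.exp (s * w j) :=
            Finset.sum_le_sum fun i _ => Real.exp_le_exp.2 (mul_le_mul_of_nonneg_left (hj i) hs.le)
        _ = _ := by simp
    have e1 : s * (w j - κ₁ / 2) = s * w j + (-1 + 1 / 2) := by
      linear_combination (-1 / 2) * hsκ
    have hk1 : Real.exp (s * w k) ≤ Real.exp (s * w j) * Real.exp (-1) := by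
      rw [← Real.exp_add]
      apply Real.exp_le_exp.2
      have : s * κ₁ ≤ s * R := mul_le_mul_of_nonneg_left hRκ hs.le
      rw [hR] at this
      linarith
    rw [e1, Real.exp_add, Real.exp_add]
    have h2 : (1 : ℝ) / 2 ≤ Real.exp (1 / 2) - 1 := by linarith [Real.add_one_le_exp (1 / 2 : ℝ)]
    have h3 : (1 : ℝ) / 3 ≤ Real.exp (-1) := by
      rw [Real.exp_neg, ← one_div]
      exact one_div_le_one_div_of_le (Real.exp_pos 1) he
    have h4 : (1 : ℝ) / 6 ≤ Real.exp (-1) * (Real.exp (1 / 2) - 1) := by nlinarith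
    have h5 : Real.exp (s * w j) * (1 / 6) ≤
        Real.exp (s * w j) * (Real.exp (-1) * Real.exp (1 / 2)) - Real.exp (s * w k) := by
      nlinarith [Real.exp_pos (s * w j)]
    have h0 := Real.exp_pos (s * w j)
    calc β / 36 * (∑ i, Real.exp (s * w i) - K) ≤ β / 36 * (K * Real.exp (s * w j)) := by
          gcongr; linarith
      _ ≤ K * β * (1 / 2) * (Real.exp (s * w j) * (1 / 6)) := by
          nlinarith [mul_nonneg (mul_nonneg hβ hK0) h0.le]
      _ ≤ K * β * (1 / 2) *
          (Real.exp (s * w j) * (Real.exp (-1) * Real.exp (1 / 2)) - Real.exp (s * w k)) := by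
          gcongr
      _ = _ := by linear_combination (K * β * (1 / 2) * (Real.exp (s * w j) *
            (Real.exp (-1) * Real.exp (1 / 2)) - Real.exp (s * w k))) * (-hsκ)

/-! ### Selection indicators, runner-up events and the coupling inequality. -/

section selection

variable {d K : ℕ} {c : Fin K → EuclideanSpace ℝ (Fin d) → ℝ}

lemma selectionIndicator_mem_Icc (g : Fin K → ℝ) (x : EuclideanSpace ℝ (Fin d)) (k : Fin K) :
    selectionIndicator c g x k ∈ Set.Icc (0 : ℝ) 1 := by
  unfold selectionIndicator; split_ifs <;> simp

lemma selectionIndicator_add_const (g : Fin K → ℝ) (a : ℝ) :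
    selectionIndicator c (fun i => g i + a) = selectionIndicator c g := by
  funext x k
  have h : (∀ j, c k x - (g k + a) ≤ c j x - (g j + a)) ↔ ∀ j, c k x - g k ≤ c j x - g j :=
    forall_congr' fun j => by constructor <;> intro h <;> linarith
  simp only [selectionIndicator, h]

lemma margin_add_const (g : Fin K → ℝ) (a : ℝ) (j k : Fin K) :
    margin c (fun i => g i + a) j k = margin c g j k := by
  funext x; simp only [margin]; ring

lemma measurable_selectionIndicator_uncurry (hc : ∀ k, Measurable (c k)) (k : Fin K) :
    Measurable fun q : (Fin K → ℝ) × EuclideanSpace ℝ (Fin d) =>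
      selectionIndicator c q.1 q.2 k := by
  unfold selectionIndicator
  refine Measurable.ite ?_ measurable_const measurable_const
  simp only [Set.ofPred_forall]
  refine MeasurableSet.iInter fun j => measurableSet_le ?_ ?_
  · exact ((hc k).comp measurable_snd).sub ((measurable_pi_apply k).comp measurable_fst)
  · exact ((hc j).comp measurable_snd).sub ((measurable_pi_apply j).comp measurable_fst)

lemma measurable_selectionIndicator (hc : ∀ k, Measurable (c k)) (g : Fin K → ℝ) (k : Fin K) :
    Measurable fun x => selectionIndicator c g x k :=
  (measurable_selectionIndicator_uncurry hc k).comp (measurable_const.prodMk measurable_id)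

lemma measurable_margin (hc : ∀ k, Measurable (c k)) (g : Fin K → ℝ) (j k : Fin K) :
    Measurable (margin c g j k) :=
  ((hc j).sub_const _).sub ((hc k).sub_const _)

variable {μ : Measure (EuclideanSpace ℝ (Fin d))}

lemma integrable_selectionIndicator [IsFiniteMeasure μ] (hc : ∀ k, Measurable (c k))
    (g : Fin K → ℝ) (k : Fin K) : Integrable (fun x => selectionIndicator c g x k) μ :=
  Integrable.of_mem_Icc 0 1 (measurable_selectionIndicator hc g k).aemeasurable
    (Filter.Eventually.of_forall fun x => selectionIndicator_mem_Icc g x k)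

/-- Ties between reduced costs are null events. -/
lemma ae_forall_sub_ne (hc : ∀ k, Measurable (c k)) (hac : CostDifferencesAC μ c)
    (g : Fin K → ℝ) : ∀ᵐ x ∂μ, ∀ j k : Fin K, j ≠ k → c j x - g j ≠ c k x - g k := by
  refine ae_all_iff.2 fun j => ae_all_iff.2 fun k => ?_
  by_cases hjk : j = k
  · simp [hjk]
  have h0 : μ.map (fun x => c j x - c k x) {g j - g k} = 0 :=
    hac j k hjk (by simp)
  have hm : Measurable fun x => c j x - c k x := (hc j).sub (hc k)
  rw [Measure.map_apply hm (measurableSet_singleton _)] at h0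
  have h1 : ∀ᵐ x ∂μ, c j x - c k x ≠ g j - g k := by
    rw [ae_iff]; simpa [Set.preimage] using h0
  filter_upwards [h1] with x hx _ h
  exact hx (by linarith)

/-- Without ties, the selection indicator picks out a single minimizing index. -/
lemma exists_sum_mul_selectionIndicator_eq [NeZero K] (g : Fin K → ℝ)
    {x : EuclideanSpace ℝ (Fin d)}
    (hx : ∀ j k : Fin K, j ≠ k → c j x - g j ≠ c k x - g k) :
    ∃ i : Fin K, (∀ j, c i x - g i ≤ c j x - g j) ∧
      ∀ f : Fin K → ℝ, ∑ k, f k * selectionIndicator c g x k = f i := by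
  obtain ⟨i, -, hi⟩ := Finset.exists_min_image Finset.univ (fun j => c j x - g j)
    Finset.univ_nonempty
  refine ⟨i, fun j => hi j (Finset.mem_univ j), fun f => ?_⟩
  rw [Finset.sum_eq_single i]
  · simp only [selectionIndicator]
    rw [if_pos fun j => hi j (Finset.mem_univ j), mul_one]
  · intro k _ hki
    simp only [selectionIndicator]
    rw [if_neg, mul_zero]
    intro h
    exact hx k i hki (le_antisymm (h i) (hi k (Finset.mem_univ k)))
  · simp

lemma ae_sum_selectionIndicator_eq_one [NeZero K] (hc : ∀ k, Measurable (c k))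
    (hac : CostDifferencesAC μ c) (g : Fin K → ℝ) :
    ∀ᵐ x ∂μ, ∑ k, selectionIndicator c g x k = 1 := by
  filter_upwards [ae_forall_sub_ne hc hac g] with x hx
  obtain ⟨i, -, h⟩ := exists_sum_mul_selectionIndicator_eq g hx
  simpa using h fun _ => 1

/-- The event that `j` is worse than `k` by at most `κ` while `k` is optimal. -/
def runnerUpEvent (c : Fin K → EuclideanSpace ℝ (Fin d) → ℝ) (g : Fin K → ℝ) (j k : Fin K)
    (κ : ℝ) : Set (EuclideanSpace ℝ (Fin d)) :=
  {x | 0 < margin c g j k x ∧ margin c g j k x ≤ κ} ∩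
    {x | ∀ l : Fin K, l ≠ j → l ≠ k → 0 ≤ margin c g l k x}

lemma measurableSet_runnerUpEvent (hc : ∀ k, Measurable (c k)) (g : Fin K → ℝ) (j k : Fin K)
    (κ : ℝ) : MeasurableSet (runnerUpEvent c g j k κ) := by
  have hm := measurable_margin hc g
  refine (measurableSet_Ioc.preimage (hm j k)).inter ?_
  simp only [Set.ofPred_forall]
  exact MeasurableSet.iInter fun l => MeasurableSet.iInter fun _ => MeasurableSet.iInter fun _ =>
    measurableSet_le measurable_const (hm l k)

lemma le_of_mem_runnerUpEvent {g : Fin K → ℝ} {j k : Fin K} {κ : ℝ}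
    {x : EuclideanSpace ℝ (Fin d)} (hx : x ∈ runnerUpEvent c g j k κ) (l : Fin K) :
    c k x - g k ≤ c l x - g l := by
  by_cases hlk : l = k
  · rw [hlk]
  by_cases hlj : l = j
  · have := hx.1.1; simp only [margin] at this; rw [hlj]; linarith
  · have := hx.2 l hlj hlk; simp only [margin] at this; linarith

/-- The density bound on (0, κ] gives the conditioning event mass at least κ₂κ, and separation keeps
a fraction κ₅ of it; κ₄ ≥ 0 makes k optimal there. -/
lemma RichDistribution.le_measureReal_runnerUpEvent [IsProbabilityMeasure μ] {gstar : Fin K → ℝ}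
    {κ₁ κ₂ κ₃ κ₄ κ₅ κ₆ : ℝ} (h : RichDistribution μ c gstar κ₁ κ₂ κ₃ κ₄ κ₅ κ₆)
    (hc : ∀ k, Measurable (c k)) (hκ₂ : 0 < κ₂) (hκ₅ : 0 < κ₅) (hκ₄ : 0 ≤ κ₄) {j k : Fin K}
    (hjk : j ≠ k) {κ : ℝ} (hκ : 0 < κ) (hκκ₁ : κ < κ₁) :
    κ₂ * κ₅ * κ ≤ μ.real (runnerUpEvent c gstar j k κ) := by
  have hm := measurable_margin hc gstar
  set B : Set (EuclideanSpace ℝ (Fin d)) :=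
    {x | 0 < margin c gstar j k x ∧ margin c gstar j k x ≤ κ} with hB
  have hBm : MeasurableSet B := measurableSet_Ioc.preimage (hm j k)
  have hBμ : ENNReal.ofReal κ₂ * ENNReal.ofReal κ ≤ μ B := by
    obtain ⟨f, hf, hmap, hfb⟩ := h.density j k hjk
    have e : μ B = μ.map (margin c gstar j k) (Set.Ioc 0 κ) := by
      rw [Measure.map_apply (hm j k) measurableSet_Ioc]; rfl
    rw [e, hmap, withDensity_apply _ measurableSet_Ioc]
    calc ENNReal.ofReal κ₂ * ENNReal.ofReal κ = ∫⁻ _ in Set.Ioc 0 κ, ENNReal.ofReal κ₂ := by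
          simp
      _ ≤ _ := setLIntegral_mono hf fun z hz => (hfb z ⟨by linarith [hz.1], by linarith [hz.2]⟩).1
  have hs := h.separation j k hjk κ hκ hκκ₁
  rw [cond_apply hBm] at hs
  have hpos : μ B ≠ 0 := by
    intro h0
    rw [h0] at hBμ
    have : 0 < ENNReal.ofReal κ₂ * ENNReal.ofReal κ :=
      ENNReal.mul_pos (by simpa using hκ₂) (by simpa using hκ)
    exact absurd hBμ (not_le.2 this)
  have hle : ENNReal.ofReal κ₅ * μ B ≤ μ (runnerUpEvent c gstar j k κ) := by
    calc ENNReal.ofReal κ₅ * μ B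
        ≤ ((μ B)⁻¹ * μ (B ∩ {x | ∀ l : Fin K, l ≠ j → l ≠ k → κ₄ ≤ margin c gstar l k x})) * μ B :=
          mul_le_mul_left hs _
      _ = μ (B ∩ {x | ∀ l : Fin K, l ≠ j → l ≠ k → κ₄ ≤ margin c gstar l k x}) := by
          rw [mul_comm, ← mul_assoc, ENNReal.mul_inv_cancel hpos (measure_ne_top _ _), one_mul]
      _ ≤ _ := measure_mono (Set.inter_subset_inter_right _
          fun x hx l h1 h2 => hκ₄.trans (hx l h1 h2))
  have hfin : ENNReal.ofReal (κ₂ * κ₅ * κ) ≤ μ (runnerUpEvent c gstar j k κ) := by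
    refine le_trans ?_ hle
    rw [mul_comm κ₂, mul_assoc, ENNReal.ofReal_mul hκ₅.le, ENNReal.ofReal_mul hκ₂.le]
    exact mul_le_mul_right hBμ _
  exact (ENNReal.ofReal_le_iff_le_toReal (measure_ne_top _ _)).1 hfin

/-- The monotone drift of the selection probabilities between two dual vectors. -/
lemma measureReal_mul_le_sum_integral_selectionIndicator_sub [NeZero K] [IsProbabilityMeasure μ]
    (hc : ∀ k, Measurable (c k)) (hac : CostDifferencesAC μ c) (g gstar : Fin K → ℝ) {φ : ℝ → ℝ}
    (hφ : Monotone φ) (j k : Fin K) (κ : ℝ) :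
    μ.real (runnerUpEvent c gstar j k κ) *
        (φ (g j - gstar j - κ) - φ (g k - gstar k)) ≤
      ∑ i, φ (g i - gstar i) * (∫ x, selectionIndicator c g x i ∂μ -
        ∫ x, selectionIndicator c gstar x i ∂μ) := by
  have hi := integrable_selectionIndicator (μ := μ) hc
  have e : ∑ i, φ (g i - gstar i) * (∫ x, selectionIndicator c g x i ∂μ -
        ∫ x, selectionIndicator c gstar x i ∂μ) =
      ∫ x, ∑ i, φ (g i - gstar i) *
        (selectionIndicator c g x i - selectionIndicator c gstar x i) ∂μ := by
    rw [integral_finsetSum (f := fun i x => φ (g i - gstar i) *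
      (selectionIndicator c g x i - selectionIndicator c gstar x i)) _
      fun i _ => ((hi g i).sub (hi gstar i)).const_mul _]
    refine Finset.sum_congr rfl fun i _ => ?_
    rw [integral_const_mul, integral_sub (hi g i) (hi gstar i)]
  have e2 : μ.real (runnerUpEvent c gstar j k κ) *
      (φ (g j - gstar j - κ) - φ (g k - gstar k)) =
      ∫ x, (runnerUpEvent c gstar j k κ).indicator
        (fun _ => φ (g j - gstar j - κ) - φ (g k - gstar k)) x ∂μ := by
    rw [integral_indicator_const _ (measurableSet_runnerUpEvent hc gstar j k κ), smul_eq_mul]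
  rw [e, e2]
  refine integral_mono_ae ((integrable_const _).indicator
    (measurableSet_runnerUpEvent hc gstar j k κ))
    (integrable_finsetSum _ fun i _ => ((hi g i).sub (hi gstar i)).const_mul _) ?_
  filter_upwards [ae_forall_sub_ne hc hac g, ae_forall_sub_ne hc hac gstar] with x hx hx'
  obtain ⟨σ, hσ, hσs⟩ := exists_sum_mul_selectionIndicator_eq g hx
  obtain ⟨τ, hτ, hτs⟩ := exists_sum_mul_selectionIndicator_eq gstar hx'
  simp only [mul_sub, Finset.sum_sub_distrib, hσs fun i => φ (g i - gstar i),
    hτs fun i => φ (g i - gstar i)]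
  by_cases hxA : x ∈ runnerUpEvent c gstar j k κ
  · rw [Set.indicator_of_mem hxA]
    have hτk : τ = k := by
      by_contra hne
      exact hx' τ k hne (le_antisymm (hτ k) (le_of_mem_runnerUpEvent hxA τ))
    rw [hτk]
    -- Under g the index σ beats j; under g* the index k beats σ and is within κ of j. Together
    -- these give w_σ ≥ w_j - κ.
    refine sub_le_sub_right (hφ ?_) _
    have h1 := hxA.1.2
    have h2 := hσ j
    have h3 := le_of_mem_runnerUpEvent hxA σ
    simp only [margin] at h1
    linarith
  · rw [Set.indicator_of_notMem hxA]
    refine sub_nonneg.2 (hφ ?_)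
    linarith [hσ τ, hτ σ]

end selection

/-! ### First-order optimality and the Lyapunov drift. -/

section optimality

variable {d K : ℕ} [NeZero K] {c : Fin K → EuclideanSpace ℝ (Fin d) → ℝ}
  {μ : Measure (EuclideanSpace ℝ (Fin d))}

lemma reducedCost_le (g : Fin K → ℝ) (x : EuclideanSpace ℝ (Fin d)) (j : Fin K) :
    reducedCost c g x ≤ c j x - g j :=
  Finset.inf'_le _ (Finset.mem_univ j)

lemma exists_reducedCost_eq (g : Fin K → ℝ) (x : EuclideanSpace ℝ (Fin d)) :
    ∃ i, reducedCost c g x = c i x - g i := by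
  obtain ⟨i, -, hi⟩ := Finset.exists_mem_eq_inf' (s := Finset.univ) Finset.univ_nonempty
    (fun j => c j x - g j)
  exact ⟨i, hi⟩

lemma integrable_reducedCost [IsFiniteMeasure μ] (hc : ∀ k, Measurable (c k))
    (hci : ∀ k, Integrable (c k) μ) (g : Fin K → ℝ) : Integrable (reducedCost c g) μ := by
  have hm : Measurable (reducedCost c g) := by
    have : reducedCost c g = Finset.univ.inf' Finset.univ_nonempty (fun j x => c j x - g j) := by
      funext x; simp [reducedCost, Finset.inf'_apply]
    rw [this]
    exact Finset.inf'_induction _ _ (fun _ ha _ hb => ha.inf hb) fun j _ => (hc j).sub_const _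
  refine Integrable.mono' (g := fun x => ∑ j, |c j x - g j|)
    (integrable_finsetSum _ fun j _ => ((hci j).sub (integrable_const _)).abs)
    hm.aestronglyMeasurable (Filter.Eventually.of_forall fun x => ?_)
  obtain ⟨i, hi⟩ := exists_reducedCost_eq (c := c) g x
  rw [hi, Real.norm_eq_abs]
  exact Finset.single_le_sum (f := fun j => |c j x - g j|) (fun j _ => abs_nonneg _)
    (Finset.mem_univ i)

/-- A supergradient inequality based at the perturbed point: raising g_k by t lowers the minimum by
at most t, and only where k attains the new minimum. It replaces differentiation under the integral.
-/
lemma reducedCost_sub_le_reducedCost_add_ite (g : Fin K → ℝ) (k : Fin K) (t : ℝ) (ht : 0 ≤ t)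
    (x : EuclideanSpace ℝ (Fin d)) :
    reducedCost c g x - t * selectionIndicator c (fun i => g i + if i = k then t else 0) x k ≤
      reducedCost c (fun i => g i + if i = k then t else 0) x := by
  have hmin := reducedCost_le (c := c) (fun i => g i + if i = k then t else 0) x
  obtain ⟨i, hi⟩ := exists_reducedCost_eq (c := c) (fun i => g i + if i = k then t else 0) x
  have h1 := reducedCost_le (c := c) g x i
  have h2 := (selectionIndicator_mem_Icc (c := c)
    (fun i => g i + if i = k then t else 0) x k).1
  by_cases hik : i = k
  · subst hik
    have h3 : selectionIndicator c (fun j => g j + if j = i then t else 0) x i = 1 := by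
      unfold selectionIndicator
      exact if_pos fun j => hi ▸ hmin j
    rw [h3, hi, if_pos rfl]
    linarith
  · rw [hi, if_neg hik]
    nlinarith

/-- First-order optimality: at a dual solution each source is selected with its prescribed
probability. -/
lemma IsDualOptimal.eq_integral_selectionIndicator [IsProbabilityMeasure μ]
    {p gstar : Fin K → ℝ} (hopt : IsDualOptimal μ c p gstar) (hc : ∀ k, Measurable (c k))
    (hci : ∀ k, Integrable (c k) μ) (hac : CostDifferencesAC μ c) (hp : ∑ k, p k = 1)
    (k : Fin K) : p k = ∫ x, selectionIndicator c gstar x k ∂μ := by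
  have hle : ∀ k, p k ≤ ∫ x, selectionIndicator c gstar x k ∂μ := by
    intro k
    have hstep : ∀ t : ℝ, 0 < t → p k ≤
        ∫ x, selectionIndicator c (fun i => gstar i + if i = k then t else 0) x k ∂μ := by
      intro t ht
      have h1 := hopt (fun i => gstar i + if i = k then t else 0)
      have h2 := integral_mono (μ := μ)
        ((integrable_reducedCost hc hci gstar).sub ((integrable_selectionIndicator hc
          (fun i => gstar i + if i = k then t else 0) k).const_mul t))
        (integrable_reducedCost hc hci _)
        (reducedCost_sub_le_reducedCost_add_ite gstar k t ht.le)
      rw [integral_sub' (integrable_reducedCost hc hci gstar) ((integrable_selectionIndicator hc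
          (fun i => gstar i + if i = k then t else 0) k).const_mul t), integral_const_mul] at h2
      simp only [dualObjective, mul_add, Finset.sum_add_distrib, mul_ite, mul_zero,
        Finset.sum_ite_eq', Finset.mem_univ, if_true] at h1
      have h3 : p k * t ≤
        (∫ x, selectionIndicator c (fun i => gstar i + if i = k then t else 0) x k ∂μ) * t := by
        linarith
      exact le_of_mul_le_mul_right h3 ht
    have hlim : Filter.Tendsto (fun n : ℕ => ∫ x, selectionIndicator c
        (fun i => gstar i + if i = k then 1 / ((n : ℝ) + 1) else 0) x k ∂μ) Filter.atTop
        (nhds (∫ x, selectionIndicator c gstar x k ∂μ)) := by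
      refine tendsto_integral_of_dominated_convergence (fun _ => 1)
        (fun n => (measurable_selectionIndicator hc _ k).aestronglyMeasurable)
        (integrable_const _) (fun n => Filter.Eventually.of_forall fun x => ?_)
        (Filter.Eventually.of_forall fun x => ?_)
      · have h := selectionIndicator_mem_Icc (c := c)
          (fun i => gstar i + if i = k then 1 / ((n : ℝ) + 1) else 0) x k
        rw [Real.norm_eq_abs, abs_of_nonneg h.1]
        exact h.2
      -- The indicators are eventually constant in n: raising g_k keeps k minimal if it was, and a
      -- strict gap survives a small increase.
      · refine tendsto_const_nhds.congr' ?_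
        by_cases hx : ∀ j, c k x - gstar k ≤ c j x - gstar j
        · refine Filter.Eventually.of_forall fun n => ?_
          simp only [selectionIndicator]
          rw [if_pos hx, if_pos]
          intro j
          have hn : 0 ≤ 1 / ((n : ℝ) + 1) := by positivity
          by_cases hjk : j = k
          · simp [hjk]
          · rw [if_pos trivial, if_neg hjk]
            linarith [hx j]
        · have hx' := hx
          push Not at hx'
          obtain ⟨j, hj⟩ := hx'
          have hjk : j ≠ k := by rintro rfl; exact lt_irrefl _ hj
          have hev := (tendsto_one_div_add_atTop_nhds_zero_nat (𝕜 := ℝ)).eventually_lt_const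
            (sub_pos.2 hj)
          filter_upwards [hev] with n hn
          simp only [selectionIndicator]
          rw [if_neg hx, if_neg]
          intro h
          have := h j
          rw [if_pos trivial, if_neg hjk] at this
          linarith
    exact ge_of_tendsto' hlim fun n => hstep _ (by positivity)
  have hsum : ∑ k, ∫ x, selectionIndicator c gstar x k ∂μ = 1 := by
    rw [← integral_finsetSum _ fun k _ => integrable_selectionIndicator hc gstar k,
      integral_congr_ae (ae_sum_selectionIndicator_eq_one hc hac gstar)]
    simp
  -- One-sided perturbations suffice: both sides sum to 1, so the inequalities are equalities.
  have := (Finset.sum_eq_sum_iff_of_le fun k (_ : k ∈ Finset.univ) => hle k).1 (hp.trans hsum.symm)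
  exact this k (Finset.mem_univ k)

/-- The separation condition bounds the number of indices. -/
lemma card_mul_le_one_of_le_measureReal_runnerUpEvent [IsProbabilityMeasure μ]
    (hc : ∀ k, Measurable (c k)) (hac : CostDifferencesAC μ c) {gstar : Fin K → ℝ} {κ q : ℝ}
    (hq : ∀ j k : Fin K, j ≠ k → q ≤ μ.real (runnerUpEvent c gstar j k κ)) {j k : Fin K}
    (hjk : j ≠ k) : K * q ≤ 1 := by
  have hle : ∀ i : Fin K, q ≤ ∫ x, selectionIndicator c gstar x i ∂μ := by
    intro i
    obtain ⟨l, hl⟩ : ∃ l, l ≠ i := by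
      by_cases h : i = k
      · exact ⟨j, h ▸ hjk⟩
      · exact ⟨k, fun h' => h h'.symm⟩
    refine (hq l i hl).trans ?_
    have hA := measurableSet_runnerUpEvent hc gstar l i κ
    have e : μ.real (runnerUpEvent c gstar l i κ) =
        ∫ x, (runnerUpEvent c gstar l i κ).indicator (fun _ => (1 : ℝ)) x ∂μ := by
      rw [integral_indicator_const _ hA, smul_eq_mul, mul_one]
    rw [e]
    refine integral_mono ((integrable_const _).indicator hA)
      (integrable_selectionIndicator hc gstar i) fun x => ?_
    by_cases hx : x ∈ runnerUpEvent c gstar l i κ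
    · simp only [Set.indicator_of_mem hx, selectionIndicator]
      rw [if_pos (le_of_mem_runnerUpEvent hx)]
    · simp only [Set.indicator_of_notMem hx]
      exact (selectionIndicator_mem_Icc gstar x i).1
  have hsum : ∑ k, ∫ x, selectionIndicator c gstar x k ∂μ = 1 := by
    rw [← integral_finsetSum _ fun k _ => integrable_selectionIndicator hc gstar k,
      integral_congr_ae (ae_sum_selectionIndicator_eq_one hc hac gstar)]
    simp
  have := Finset.sum_le_sum fun i (_ : i ∈ Finset.univ) => hle i
  rw [hsum] at this
  simpa using this

/-- The exponential Lyapunov drift of the stochastic gradient. -/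
lemma mul_sum_exp_sub_card_le_drift [IsProbabilityMeasure μ]
    (hc : ∀ k, Measurable (c k)) (hac : CostDifferencesAC μ c) {g gstar : Fin K → ℝ} {κ₁ β : ℝ}
    (hκ₁ : 0 < κ₁) (hβ : 0 < β)
    (hq : ∀ j k : Fin K, j ≠ k → ∀ κ, 0 < κ → κ < κ₁ →
      β * κ ≤ μ.real (runnerUpEvent c gstar j k κ))
    (hg : ∑ i, (g i - gstar i) = 0) :
    κ₁ * β ^ 2 / 72 * (∑ i, Real.exp (1 / κ₁ * (g i - gstar i)) - K) ≤
      1 / κ₁ * ∑ i, Real.exp (1 / κ₁ * (g i - gstar i)) *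
        (∫ x, selectionIndicator c g x i ∂μ - ∫ x, selectionIndicator c gstar x i ∂μ) := by
  have hs : 0 < 1 / κ₁ := by positivity
  have hmono : Monotone fun y : ℝ => Real.exp (1 / κ₁ * y) := fun a b hab =>
    Real.exp_le_exp.2 (mul_le_mul_of_nonneg_left hab hs.le)
  obtain ⟨j, -, hj⟩ := Finset.exists_max_image Finset.univ (fun i => g i - gstar i)
    Finset.univ_nonempty
  obtain ⟨k, -, hk⟩ := Finset.exists_min_image Finset.univ (fun i => g i - gstar i)
    Finset.univ_nonempty
  have hj' : ∀ i, g i - gstar i ≤ g j - gstar j := fun i => hj i (Finset.mem_univ i)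
  have hk' : ∀ i, g k - gstar k ≤ g i - gstar i := fun i => hk i (Finset.mem_univ i)
  have hdrift := measureReal_mul_le_sum_integral_selectionIndicator_sub hc hac g gstar hmono j k
  have han := drift_lower_bound hκ₁ hβ.le (fun i => g i - gstar i) hg hj' hk'
  set V := ∑ i, Real.exp (1 / κ₁ * (g i - gstar i)) - (K : ℝ)
  set T := ∑ i, Real.exp (1 / κ₁ * (g i - gstar i)) *
    (∫ x, selectionIndicator c g x i ∂μ - ∫ x, selectionIndicator c gstar x i ∂μ)
  set R := g j - gstar j - (g k - gstar k) with hR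
  have hK1 : (1 : ℝ) ≤ K := by exact_mod_cast Nat.one_le_iff_ne_zero.2 (NeZero.ne K)
  -- Zero spread means w = 0. This case includes K = 1, where no pair of distinct indices exists.
  rcases (sub_nonneg.2 (hk' j)).eq_or_lt with hR0 | hRpos
  · have hT : 0 ≤ T := by
      have := hdrift 0
      rwa [show g j - gstar j - 0 = g k - gstar k by linarith, sub_self, mul_zero] at this
    rw [← hR] at hR0
    rw [← hR0, min_eq_left hκ₁.le] at han
    simp only [zero_div, mul_zero, zero_mul] at han
    have hV : V ≤ 0 := by
      by_contra! h
      have : 0 < β / 36 * V := by positivity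
      linarith
    have h1 : κ₁ * β ^ 2 / 72 * V ≤ 0 := mul_nonpos_of_nonneg_of_nonpos (by positivity) hV
    exact h1.trans (by positivity)
  · rw [← hR] at hRpos
    have hjk : j ≠ k := by rintro rfl; simp [hR] at hRpos
    -- Halving keeps κ strictly below κ₁ and leaves w_j - κ at least R/2 above w_k.
    set κ := min R κ₁ / 2 with hκ
    have hκ0 : 0 < κ := by positivity
    have hκκ₁ : κ < κ₁ := by
      have := min_le_right R κ₁
      linarith
    have hκR : κ ≤ R := by
      have := min_le_left R κ₁
      linarith
    have hexp : 0 ≤ Real.exp (1 / κ₁ * (g j - gstar j - κ)) -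
        Real.exp (1 / κ₁ * (g k - gstar k)) :=
      sub_nonneg.2 (hmono (by linarith))
    have hT1 : β * κ * (Real.exp (1 / κ₁ * (g j - gstar j - κ)) -
        Real.exp (1 / κ₁ * (g k - gstar k))) ≤ T :=
      (mul_le_mul_of_nonneg_right (hq j k hjk κ hκ0 hκκ₁) hexp).trans (hdrift κ)
    have hT0 : 0 ≤ T := le_trans (by positivity) hT1
    -- This trades the factor K in the drift bound for 2/(βκ₁), which yields the K-free rate
    -- κ₁β²/72.
    have hcard : K * (β * (κ₁ / 2)) ≤ 1 :=
      card_mul_le_one_of_le_measureReal_runnerUpEvent hc hac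
        (fun j k h => hq j k h _ (by positivity) (by linarith)) hjk
    have h1 : β / 36 * V ≤ K * (1 / κ₁ * T) :=
      han.trans (mul_le_mul_of_nonneg_left (mul_le_mul_of_nonneg_left hT1 hs.le) (by positivity))
    have h2 : 0 ≤ 1 / κ₁ * T := by positivity
    calc κ₁ * β ^ 2 / 72 * V = β * (κ₁ / 2) * (β / 36 * V) := by ring
      _ ≤ β * (κ₁ / 2) * (K * (1 / κ₁ * T)) := mul_le_mul_of_nonneg_left h1 (by positivity)
      _ = K * (β * (κ₁ / 2)) * (1 / κ₁ * T) := by ring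
      _ ≤ 1 * (1 / κ₁ * T) := mul_le_mul_of_nonneg_right hcard h2
      _ = _ := one_mul _

end optimality

/-! ### Conditioning on the past and properties of the iterates. -/

/-- Comparison of expectations by conditioning on the first of two independent variables. -/
lemma integral_le_integral_of_indepFun {Ω A B : Type*} [MeasurableSpace Ω] [MeasurableSpace A]
    [MeasurableSpace B] {P : Measure Ω} [IsProbabilityMeasure P] {G : Ω → A} {Y : Ω → B}
    (hG : Measurable G) (hY : Measurable Y) (hind : IndepFun G Y P) {H : A × B → ℝ} {u : A → ℝ}
    (hH : Measurable H) (hHi : Integrable (fun ω => H (G ω, Y ω)) P)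
    (hu : Measurable u) (hui : Integrable (fun ω => u (G ω)) P) {S : Set A}
    (hSm : MeasurableSet S) (hS : ∀ᵐ ω ∂P, G ω ∈ S)
    (h : ∀ a ∈ S, ∫ b, H (a, b) ∂(P.map Y) ≤ u a) :
    ∫ ω, H (G ω, Y ω) ∂P ≤ ∫ ω, u (G ω) ∂P := by
  have : IsProbabilityMeasure (P.map Y) := Measure.isProbabilityMeasure_map hY.aemeasurable
  have : IsProbabilityMeasure (P.map G) := Measure.isProbabilityMeasure_map hG.aemeasurable
  have hjoint := hind.map_prod_eq_prod_map_map hG.aemeasurable hY.aemeasurable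
  have hGY : Measurable fun ω => (G ω, Y ω) := hG.prodMk hY
  have hHi' : Integrable H ((P.map G).prod (P.map Y)) := by
    rw [← hjoint]
    exact (integrable_map_measure hH.aestronglyMeasurable hGY.aemeasurable).2 hHi
  have hui' : Integrable u (P.map G) :=
    (integrable_map_measure hu.aestronglyMeasurable hG.aemeasurable).2 hui
  rw [← integral_map hGY.aemeasurable (f := H) hH.aestronglyMeasurable, hjoint,
    integral_prod _ hHi', ← integral_map hG.aemeasurable (f := u) hu.aestronglyMeasurable]
  refine integral_mono_ae hHi'.integral_prod_left hui' ?_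
  have hS' : ∀ᵐ a ∂(P.map G), a ∈ S := (ae_map_iff hG.aemeasurable hSm).2 hS
  filter_upwards [hS'] with a ha
  exact h a ha

section iterates

variable {d K : ℕ} {c : Fin K → EuclideanSpace ℝ (Fin d) → ℝ} {p g0 : Fin K → ℝ} {α : ℝ}

lemma abs_sub_selectionIndicator_le (p g : Fin K → ℝ) (x : EuclideanSpace ℝ (Fin d)) (k : Fin K) :
    |p k - selectionIndicator c g x k| ≤ |p k| + 1 := by
  have h := selectionIndicator_mem_Icc (c := c) g x k
  refine (abs_sub _ _).trans ?_
  rw [abs_of_nonneg h.1]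
  linarith [h.2]

/-- A crude deterministic bound, depending on n, which serves only for integrability. -/
lemma exists_abs_saIterate_le (hα : 0 ≤ α) (n : ℕ) :
    ∃ B : ℝ, ∀ (x : ℕ → EuclideanSpace ℝ (Fin d)) (k : Fin K),
      |saIterate c p α g0 x n k| ≤ B := by
  induction n with
  | zero =>
    refine ⟨∑ k, |g0 k|, fun x k => ?_⟩
    exact Finset.single_le_sum (f := fun k => |g0 k|) (fun j _ => abs_nonneg _)
      (Finset.mem_univ k)
  | succ n ih =>
    obtain ⟨B, hB⟩ := ih
    refine ⟨B + α / ((n : ℝ) + 1) * (∑ k, |p k| + 1), fun x k => ?_⟩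
    have hn : 0 ≤ α / ((n : ℝ) + 1) := by positivity
    simp only [saIterate]
    refine (abs_add_le _ _).trans (add_le_add (hB x k) ?_)
    rw [abs_mul, abs_of_nonneg hn]
    refine mul_le_mul_of_nonneg_left ((abs_sub_selectionIndicator_le p _ _ k).trans ?_) hn
    have := Finset.single_le_sum (f := fun k => |p k|) (fun j _ => abs_nonneg _)
      (Finset.mem_univ k)
    simpa using this

/-- Measurability is asked only of the observations before n, so that the lemma also applies to the
σ-algebra they generate; this is how independence from `X n` is obtained. -/
lemma measurable_saIterate {Ω : Type*} [MeasurableSpace Ω] (hc : ∀ k, Measurable (c k))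
    {X : ℕ → Ω → EuclideanSpace ℝ (Fin d)} (n : ℕ) (hX : ∀ i < n, Measurable (X i)) :
    Measurable fun ω => saIterate c p α g0 (fun m => X m ω) n := by
  induction n with
  | zero => exact measurable_const
  | succ n ih =>
    have ih' := ih fun i hi => hX i (by omega)
    refine measurable_pi_iff.2 fun k => ?_
    simp only [saIterate]
    refine ((measurable_pi_apply k).comp ih').add (Measurable.const_mul ?_ _)
    exact measurable_const.sub ((measurable_selectionIndicator_uncurry hc k).comp
      (ih'.prodMk (hX n (Nat.lt_succ_self n))))

variable {Ω : Type*} [MeasurableSpace Ω] {P : Measure Ω}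
  {X : ℕ → Ω → EuclideanSpace ℝ (Fin d)}

lemma indepFun_saIterate (hc : ∀ k, Measurable (c k)) (hX : ∀ n, Measurable (X n))
    (hind : iIndepFun X P) (n : ℕ) :
    IndepFun (fun ω => saIterate c p α g0 (fun m => X m ω) n) (X n) P := by
  have h := indep_iSup_of_disjoint (fun i => (hX i).comap_le) hind.iIndep
    (S := Set.Iio n) (T := {n}) (by simp)
  rw [IndepFun_iff_Indep]
  refine indep_of_indep_of_le_left (indep_of_indep_of_le_right h ?_) ?_
  · exact le_iSup₂_of_le n rfl le_rfl
  · refine Measurable.comap_le ?_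
    refine @measurable_saIterate d K c p g0 α Ω (⨆ i ∈ Set.Iio n,
      MeasurableSpace.comap (X i) inferInstance) hc X n fun i hi => ?_
    exact (comap_measurable (X i)).mono (le_iSup₂_of_le i hi le_rfl) le_rfl

/-- A continuous function of the iterate is integrable. -/
lemma integrable_comp_saIterate [IsFiniteMeasure P] (hc : ∀ k, Measurable (c k))
    (hX : ∀ n, Measurable (X n)) (hα : 0 ≤ α) (n : ℕ) {f : (Fin K → ℝ) → ℝ} (hf : Continuous f) :
    Integrable (fun ω => f (saIterate c p α g0 (fun m => X m ω) n)) P := by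
  obtain ⟨B, hB⟩ := exists_abs_saIterate_le (d := d) (c := c) (p := p) (g0 := g0) hα n
  obtain ⟨C, hC⟩ := (isCompact_univ_pi fun _ : Fin K =>
    isCompact_Icc (a := -B) (b := B)).exists_bound_of_continuousOn hf.continuousOn
  refine Integrable.of_bound
    (hf.measurable.comp (measurable_saIterate hc n fun i _ => hX i)).aestronglyMeasurable C
    (Filter.Eventually.of_forall fun ω => hC _ ?_)
  exact Set.mem_univ_pi.2 fun k => abs_le.1 (hB _ k)

lemma ae_sum_saIterate_eq [NeZero K] [IsProbabilityMeasure P] (hc : ∀ k, Measurable (c k))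
    {μ : Measure (EuclideanSpace ℝ (Fin d))} [IsProbabilityMeasure μ]
    (hac : CostDifferencesAC μ c) (hp : ∑ k, p k = 1) (hX : ∀ n, Measurable (X n))
    (hμ : ∀ n, P.map (X n) = μ) (hind : iIndepFun X P) (n : ℕ) :
    ∀ᵐ ω ∂P, ∑ k, saIterate c p α g0 (fun m => X m ω) n k = ∑ k, g0 k := by
  induction n with
  | zero => simp [saIterate]
  | succ n ih =>
    have hG : Measurable fun ω => saIterate c p α g0 (fun m => X m ω) n :=
      measurable_saIterate hc n fun i _ => hX i
    have : IsProbabilityMeasure (P.map fun ω => saIterate c p α g0 (fun m => X m ω) n) :=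
      Measure.isProbabilityMeasure_map hG.aemeasurable
    have hjoint := (indepFun_saIterate (p := p) (g0 := g0) (α := α) hc hX hind
      n).map_prod_eq_prod_map_map hG.aemeasurable (hX n).aemeasurable
    have hm : MeasurableSet {q : (Fin K → ℝ) × EuclideanSpace ℝ (Fin d) |
        ∑ k, selectionIndicator c q.1 q.2 k = 1} :=
      measurableSet_eq_fun (Finset.measurable_fun_sum _ fun k _ =>
        measurable_selectionIndicator_uncurry hc k) measurable_const
    have hae : ∀ᵐ q ∂((P.map fun ω => saIterate c p α g0 (fun m => X m ω) n).prod (P.map (X n))),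
        ∑ k, selectionIndicator c q.1 q.2 k = 1 := by
      -- The null set of ties depends on g; independence and Fubini carry the statement for each
      -- fixed g over to the random iterate.
      rw [Measure.ae_prod_iff_ae_ae hm, hμ n]
      exact Filter.Eventually.of_forall fun g => ae_sum_selectionIndicator_eq_one hc hac g
    rw [← hjoint, ae_map_iff (hG.prodMk (hX n)).aemeasurable hm] at hae
    filter_upwards [ih, hae] with ω h1 h2
    simp only [saIterate, Finset.sum_add_distrib, h1, ← Finset.mul_sum, Finset.sum_sub_distrib, hp]
    rw [h2, sub_self, mul_zero, add_zero]

end iterates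

/-! ### One-step inequality and the rate for a matched dual solution. -/

section rate

variable {d K : ℕ} {c : Fin K → EuclideanSpace ℝ (Fin d) → ℝ}
  {μ : Measure (EuclideanSpace ℝ (Fin d))} [IsProbabilityMeasure μ] {p gstar : Fin K → ℝ}

/-- One step of the stochastic gradient method, integrated over the new observation. -/
lemma integral_sum_exp_step_le (hc : ∀ k, Measurable (c k)) (hp0 : ∀ k, 0 ≤ p k)
    (hp : ∑ k, p k = 1) {s α γ : ℝ} (hs : 0 ≤ s) (hγ : 0 ≤ γ) (hγα : γ ≤ α)
    (g : Fin K → ℝ) :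
    ∫ x, ∑ k, Real.exp (s * (g k + γ * (p k - selectionIndicator c g x k) - gstar k)) ∂μ ≤
      (1 + s ^ 2 * γ ^ 2 * Real.exp (s * α)) * ∑ k, Real.exp (s * (g k - gstar k)) -
        γ * (s * ∑ k, Real.exp (s * (g k - gstar k)) *
          (∫ x, selectionIndicator c g x k ∂μ - p k)) := by
  have hp1 : ∀ k, p k ≤ 1 := fun k => by
    rw [← hp]; exact Finset.single_le_sum (fun i _ => hp0 i) (Finset.mem_univ k)
  have hi := integrable_selectionIndicator (μ := μ) hc g
  have habs : ∀ x k, |p k - selectionIndicator c g x k| ≤ 1 := fun x k => by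
    have h := selectionIndicator_mem_Icc (c := c) g x k
    rw [abs_le]
    constructor <;> linarith [h.1, h.2, hp0 k, hp1 k]
  have hpt : ∀ x k, Real.exp (s * (g k + γ * (p k - selectionIndicator c g x k) - gstar k)) ≤
      Real.exp (s * (g k - gstar k)) * (1 + s ^ 2 * γ ^ 2 * Real.exp (s * α)) +
        Real.exp (s * (g k - gstar k)) * (γ * s) * (p k - selectionIndicator c g x k) := by
    intro x k
    set ξ := p k - selectionIndicator c g x k
    have e : s * (g k + γ * ξ - gstar k) = s * (g k - gstar k) + s * γ * ξ := by ring
    have hsγ : 0 ≤ s * γ := mul_nonneg hs hγ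
    have hu : |s * γ * ξ| ≤ s * α := by
      rw [abs_mul, abs_of_nonneg hsγ]
      calc s * γ * |ξ| ≤ s * γ * 1 := mul_le_mul_of_nonneg_left (habs x k) hsγ
        _ ≤ s * α := by rw [mul_one]; exact mul_le_mul_of_nonneg_left hγα hs
    have hξ : ξ ^ 2 ≤ 1 := by rw [← sq_abs]; exact pow_le_one₀ (abs_nonneg _) (habs x k)
    have h1 := exp_le_one_add_add_sq_mul_exp_abs (s * γ * ξ)
    -- The second-order error is multiplicative in W, with a factor O(γ²) uniform in g because |ξ| ≤
    -- 1 and γ ≤ α.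
    have h2 : (s * γ * ξ) ^ 2 * Real.exp |s * γ * ξ| ≤ s ^ 2 * γ ^ 2 * Real.exp (s * α) := by
      refine mul_le_mul ?_ (Real.exp_le_exp.2 hu) (Real.exp_pos _).le (by positivity)
      rw [mul_pow, mul_pow]
      exact mul_le_of_le_one_right (by positivity) hξ
    rw [e, Real.exp_add]
    calc Real.exp (s * (g k - gstar k)) * Real.exp (s * γ * ξ)
        ≤ Real.exp (s * (g k - gstar k)) *
          (1 + s * γ * ξ + s ^ 2 * γ ^ 2 * Real.exp (s * α)) :=
          mul_le_mul_of_nonneg_left (by linarith) (Real.exp_pos _).le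
      _ = _ := by ring
  have hint : ∀ k, Integrable (fun x =>
      Real.exp (s * (g k - gstar k)) * (1 + s ^ 2 * γ ^ 2 * Real.exp (s * α)) +
        Real.exp (s * (g k - gstar k)) * (γ * s) * (p k - selectionIndicator c g x k)) μ :=
    fun k => (integrable_const _).add (((integrable_const _).sub (hi k)).const_mul _)
  calc _ ≤ ∫ x, ∑ k, (Real.exp (s * (g k - gstar k)) * (1 + s ^ 2 * γ ^ 2 * Real.exp (s * α)) +
        Real.exp (s * (g k - gstar k)) * (γ * s) * (p k - selectionIndicator c g x k)) ∂μ :=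
        integral_mono_of_nonneg
          (Filter.Eventually.of_forall fun x => Finset.sum_nonneg fun k _ => (Real.exp_pos _).le)
          (integrable_finsetSum _ fun k _ => hint k)
          (Filter.Eventually.of_forall fun x => Finset.sum_le_sum fun k _ => hpt x k)
    _ = ∑ k, (Real.exp (s * (g k - gstar k)) * (1 + s ^ 2 * γ ^ 2 * Real.exp (s * α)) +
        Real.exp (s * (g k - gstar k)) * (γ * s) *
          (p k - ∫ x, selectionIndicator c g x k ∂μ)) := by
        rw [integral_finsetSum _ fun k _ => hint k]
        refine Finset.sum_congr rfl fun k _ => ?_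
        have hsub : Integrable (fun x => p k - selectionIndicator c g x k) μ :=
          (integrable_const _).sub (hi k)
        rw [integral_add (integrable_const _) (hsub.const_mul _), integral_const,
          integral_const_mul, integral_sub (integrable_const _) (hi k)]
        simp
    _ = _ := by
        rw [Finset.sum_add_distrib, ← Finset.sum_mul, Finset.mul_sum, Finset.mul_sum,
          Finset.mul_sum, sub_eq_add_neg, ← Finset.sum_neg_distrib, mul_comm, Finset.mul_sum]
        congr 1
        exact Finset.sum_congr rfl fun k _ => by ring

/-- The `1 / n` rate for a dual solution with the same coordinate sum as the starting point. -/
lemma exists_integral_sqDist_saIterate_le [NeZero K] {Ω : Type*} [MeasurableSpace Ω] {P : Measure Ω}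
    [IsProbabilityMeasure P] {X : ℕ → Ω → EuclideanSpace ℝ (Fin d)} {g0 : Fin K → ℝ} {κ₁ β α : ℝ}
    (hc : ∀ k, Measurable (c k)) (hac : CostDifferencesAC μ c) (hp0 : ∀ k, 0 ≤ p k)
    (hp : ∑ k, p k = 1) (hpg : ∀ k, p k = ∫ x, selectionIndicator c gstar x k ∂μ)
    (hκ₁ : 0 < κ₁) (hβ : 0 < β)
    (hq : ∀ j k : Fin K, j ≠ k → ∀ κ, 0 < κ → κ < κ₁ →
      β * κ ≤ μ.real (runnerUpEvent c gstar j k κ))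
    (hX : ∀ n, Measurable (X n)) (hμ : ∀ n, P.map (X n) = μ) (hind : iIndepFun X P)
    (hsum : ∑ k, g0 k = ∑ k, gstar k) (hα : 72 / (κ₁ * β ^ 2) < α) :
    ∃ D : ℝ, ∀ n : ℕ, 1 ≤ n →
      ∫ ω, sqDist (saIterate c p α g0 (fun m => X m ω) n) gstar ∂P ≤ D / n := by
  have hα0 : 0 < α := lt_trans (by positivity) hα
  set s := 1 / κ₁ with hs_def
  have hs : 0 < s := by positivity
  set a := κ₁ * β ^ 2 / 72 with ha
  have haα : 1 < a * α := by
    rw [div_lt_iff₀ (by positivity)] at hα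
    rw [ha]; linarith
  set G : ℕ → Ω → Fin K → ℝ := fun n ω => saIterate c p α g0 (fun m => X m ω) n with hGdef
  set W : (Fin K → ℝ) → ℝ := fun g => ∑ k, Real.exp (s * (g k - gstar k)) with hW
  have hWc : Continuous W := by rw [hW]; fun_prop
  have hGi : ∀ n {f : (Fin K → ℝ) → ℝ}, Continuous f → Integrable (fun ω => f (G n ω)) P :=
    fun n f hf => integrable_comp_saIterate hc hX hα0.le n hf
  have hG0 : ∀ n, ∀ᵐ ω ∂P, ∑ k, (G n ω k - gstar k) = 0 := fun n => by
    filter_upwards [ae_sum_saIterate_eq (α := α) (g0 := g0) hc hac hp hX hμ hind n] with ω hω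
    rw [Finset.sum_sub_distrib, hω, hsum, sub_self]
  set C := s ^ 2 * α ^ 2 * Real.exp (s * α) with hC
  have hC0 : 0 ≤ C := by positivity
  have hrec : ∀ n : ℕ, ∫ ω, (W (G (n + 1) ω) - K) ∂P ≤
      (1 - a * α / ((n : ℝ) + 1) + C / ((n : ℝ) + 1) ^ 2) * ∫ ω, (W (G n ω) - K) ∂P +
        K * C / ((n : ℝ) + 1) ^ 2 := by
    intro n
    set γ := α / ((n : ℝ) + 1) with hγ
    have hγ0 : 0 ≤ γ := by positivity
    have hγα : γ ≤ α := div_le_self hα0.le (by linarith [Nat.cast_nonneg (α := ℝ) n])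
    have hCγ : C / ((n : ℝ) + 1) ^ 2 = s ^ 2 * γ ^ 2 * Real.exp (s * α) := by
      rw [hC, hγ]; field_simp
    have haγ : a * α / ((n : ℝ) + 1) = a * γ := by rw [hγ]; ring
    have hKC : K * C / ((n : ℝ) + 1) ^ 2 = K * (s ^ 2 * γ ^ 2 * Real.exp (s * α)) := by
      rw [← hCγ]; ring
    rw [hKC, hCγ, haγ]
    set ε := s ^ 2 * γ ^ 2 * Real.exp (s * α) with hε
    have hu : Continuous fun g => (1 - a * γ + ε) * (W g - K) + K * ε + K := by fun_prop
    have hHm : Measurable fun q : (Fin K → ℝ) × EuclideanSpace ℝ (Fin d) =>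
        ∑ k, Real.exp (s * (q.1 k + γ * (p k - selectionIndicator c q.1 q.2 k) - gstar k)) := by
      refine Finset.measurable_fun_sum _ fun k _ => Real.measurable_exp.comp ?_
      have h1 := measurable_selectionIndicator_uncurry (d := d) hc k
      have h2 : Measurable fun q : (Fin K → ℝ) × EuclideanSpace ℝ (Fin d) => q.1 k :=
        (measurable_pi_apply k).comp measurable_fst
      exact ((h2.add ((measurable_const.sub h1).const_mul γ)).sub_const _).const_mul s
    have hmain := integral_le_integral_of_indepFun (P := P) (S := {g | ∑ k, (g k - gstar k) = 0})
      (measurable_saIterate (p := p) (g0 := g0) (α := α) hc n fun i _ => hX i) (hX n)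
      (indepFun_saIterate hc hX hind n) hHm (hGi (n + 1) hWc) hu.measurable (hGi n hu)
      (measurableSet_eq_fun (by fun_prop) measurable_const) (hG0 n) (fun g hg => by
        rw [hμ n]
        have hstep := integral_sum_exp_step_le (μ := μ) (gstar := gstar) hc hp0 hp hs.le hγ0 hγα g
        rw [← hε] at hstep
        refine hstep.trans ?_
        have hd := mul_sum_exp_sub_card_le_drift (g := g) hc hac hκ₁ hβ hq hg
        simp only [← hpg] at hd
        have hd' := mul_le_mul_of_nonneg_left hd hγ0
        rw [← hs_def, ← ha] at hd'
        simp only [hW]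
        linarith)
    have e1 : ∫ ω, (W (G (n + 1) ω) - K) ∂P = ∫ ω, W (G (n + 1) ω) ∂P - K := by
      rw [integral_sub (hGi _ hWc) (integrable_const _)]; simp
    have e2 : ∫ ω, ((1 - a * γ + ε) * (W (G n ω) - K) + K * ε + K) ∂P =
        (1 - a * γ + ε) * ∫ ω, (W (G n ω) - K) ∂P + K * ε + K := by
      have h1 : Integrable (fun ω => W (G n ω) - K) P := (hGi n hWc).sub (integrable_const _)
      have h2 : Integrable (fun ω => (1 - a * γ + ε) * (W (G n ω) - K) + K * ε) P :=
        (h1.const_mul _).add (integrable_const _)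
      rw [integral_add h2 (integrable_const _),
        integral_add (h1.const_mul _) (integrable_const _), integral_const_mul]
      simp
    rw [e1]
    have hmain' : ∫ ω, W (G (n + 1) ω) ∂P ≤
        ∫ ω, ((1 - a * γ + ε) * (W (G n ω) - K) + K * ε + K) ∂P := hmain
    rw [e2] at hmain'
    linarith
  obtain ⟨D, hD⟩ := exists_le_div_of_recursion
    (E := fun n => ∫ ω, (W (G n ω) - K) ∂P) haα hC0
    (mul_nonneg (Nat.cast_nonneg K) hC0) hrec
  refine ⟨K ^ 3 * (2 / s ^ 2) * D, fun n hn => ?_⟩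
  have hsq : Continuous fun g : Fin K → ℝ => sqDist g gstar := by unfold sqDist; fun_prop
  calc ∫ ω, sqDist (G n ω) gstar ∂P ≤ ∫ ω, K ^ 3 * (2 / s ^ 2) * (W (G n ω) - K) ∂P := by
        refine integral_mono_ae (hGi n hsq)
          (((hGi n hWc).sub (integrable_const _)).const_mul _) ?_
        filter_upwards [hG0 n] with ω hω
        exact sum_sq_le_sum_exp_sub_card hs (fun k => G n ω k - gstar k) hω
    _ = K ^ 3 * (2 / s ^ 2) * ∫ ω, (W (G n ω) - K) ∂P := integral_const_mul _ _
    _ ≤ K ^ 3 * (2 / s ^ 2) * (D / n) := mul_le_mul_of_nonneg_left (hD n hn) (by positivity)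
    _ = _ := by ring

end rate

/-! ### Normalization and the main theorem. -/

lemma sqDist_normalizeFirst_le {K : ℕ} [NeZero K] (g h : Fin K → ℝ) :
    sqDist (normalizeFirst g) (normalizeFirst h) ≤ 2 * (1 + K) * sqDist g h := by
  have h0 : (g 0 - h 0) ^ 2 ≤ sqDist g h :=
    Finset.single_le_sum (f := fun k => (g k - h k) ^ 2) (fun k _ => sq_nonneg _)
      (Finset.mem_univ 0)
  calc sqDist (normalizeFirst g) (normalizeFirst h)
      ≤ ∑ k, (2 * (g k - h k) ^ 2 + 2 * (g 0 - h 0) ^ 2) := by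
        refine Finset.sum_le_sum fun k _ => ?_
        simp only [normalizeFirst]
        nlinarith [sq_nonneg ((g k - h k) + (g 0 - h 0))]
    _ = 2 * sqDist g h + K * (2 * (g 0 - h 0) ^ 2) := by
        simp [Finset.sum_add_distrib, ← Finset.mul_sum, sqDist]
    _ ≤ _ := by nlinarith [Nat.cast_nonneg (α := ℝ) K]

theorem theorem1 (κ₁ κ₂ κ₅ : ℝ) (hκ₁ : 0 < κ₁) (hκ₂ : 0 < κ₂) (hκ₅ : 0 < κ₅) :
    ∃ αbar : ℝ, 0 < αbar ∧
      ∀ (d K : ℕ) [NeZero K] (κ₃ κ₄ κ₆ : ℝ), 0 ≤ κ₄ →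
      ∀ (μ : Measure (EuclideanSpace ℝ (Fin d))) [IsProbabilityMeasure μ]
        (c : Fin K → EuclideanSpace ℝ (Fin d) → ℝ) (p gstar : Fin K → ℝ),
        (∀ k, Measurable (c k)) → (∀ k, Integrable (c k) μ) →
        (∀ k, 0 ≤ p k) → ∑ k, p k = 1 →
        IsDualOptimal μ c p gstar →
        CostDifferencesAC μ c →
        RichDistribution μ c gstar κ₁ κ₂ κ₃ κ₄ κ₅ κ₆ →
      ∀ (Ω : Type*) [MeasurableSpace Ω] (P : Measure Ω) [IsProbabilityMeasure P]
        (X : ℕ → Ω → EuclideanSpace ℝ (Fin d)),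
        (∀ n, Measurable (X n)) → (∀ n, P.map (X n) = μ) → iIndepFun X P →
      ∀ (g0 : Fin K → ℝ) (α : ℝ), αbar < α →
      ∃ D : ℝ, ∀ n : ℕ, 1 ≤ n →
        (Integrable (fun ω => sqDist
            (normalizeFirst (saIterate c p α g0 (fun m => X m ω) n)) (normalizeFirst gstar)) P ∧
          ∫ ω, sqDist
            (normalizeFirst (saIterate c p α g0 (fun m => X m ω) n)) (normalizeFirst gstar) ∂P
              ≤ D / n) ∧
        (∑ k, g0 k = ∑ k, gstar k →
          Integrable (fun ω => sqDist (saIterate c p α g0 (fun m => X m ω) n) gstar) P ∧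
          ∫ ω, sqDist (saIterate c p α g0 (fun m => X m ω) n) gstar ∂P ≤ D / n) := by
  -- The reciprocal of the drift rate a = κ₁β²/72 with β = κ₂κ₅, so that aα > 1.
  refine ⟨72 / (κ₁ * (κ₂ * κ₅) ^ 2), by positivity, ?_⟩
  intro d K _ κ₃ κ₄ κ₆ hκ₄ μ _ c p gstar hc hci hp0 hp hopt hac hrich Ω _ P _ X hX hμ hind g0 α hα
  have hα0 : 0 < α := lt_trans (by positivity) hα
  have hK : (K : ℝ) ≠ 0 := Nat.cast_ne_zero.2 (NeZero.ne K)
  set b : ℝ := (∑ k, g0 k - ∑ k, gstar k) / K with hb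
  -- The translate of g* with the coordinate sum of g⁰. Selection, margins and normalization do not
  -- see the shift.
  set h : Fin K → ℝ := fun i => gstar i + b with hh
  have hsum : ∑ k, g0 k = ∑ k, h k := by
    simp only [hh, Finset.sum_add_distrib, Finset.sum_const, Finset.card_univ, Fintype.card_fin,
      nsmul_eq_mul, hb]
    field_simp
    ring
  have hnorm : normalizeFirst h = normalizeFirst gstar := by
    funext k; simp [normalizeFirst, hh]
  have hpg : ∀ k, p k = ∫ x, selectionIndicator c h x k ∂μ := by
    rw [hh, selectionIndicator_add_const]
    exact hopt.eq_integral_selectionIndicator hc hci hac hp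
  have hq : ∀ j k : Fin K, j ≠ k → ∀ κ, 0 < κ → κ < κ₁ →
      κ₂ * κ₅ * κ ≤ μ.real (runnerUpEvent c h j k κ) := by
    intro j k hjk κ h0 h1
    simp only [runnerUpEvent, hh, margin_add_const]
    exact hrich.le_measureReal_runnerUpEvent hc hκ₂ hκ₅ hκ₄ hjk h0 h1
  obtain ⟨D, hD⟩ := exists_integral_sqDist_saIterate_le hc hac hp0 hp hpg hκ₁ (mul_pos hκ₂ hκ₅) hq
    hX hμ hind hsum hα
  have hint : ∀ n {f : (Fin K → ℝ) → ℝ}, Continuous f →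
      Integrable (fun ω => f (saIterate c p α g0 (fun m => X m ω) n)) P :=
    fun n f hf => integrable_comp_saIterate hc hX hα0.le n hf
  have hsq : ∀ v : Fin K → ℝ, Continuous fun g : Fin K → ℝ => sqDist g v := fun v => by
    unfold sqDist; fun_prop
  have hsqn : Continuous fun g : Fin K → ℝ =>
      sqDist (normalizeFirst g) (normalizeFirst gstar) := by
    unfold sqDist normalizeFirst; fun_prop
  have hD0 : 0 ≤ D := by
    have h1 := hD 1 le_rfl
    rw [Nat.cast_one, div_one] at h1
    exact le_trans (integral_nonneg fun ω => Finset.sum_nonneg fun k _ => sq_nonneg _) h1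
  -- The factor is the cost of normalizing the first entry; being at least 1, it also serves the
  -- second claim.
  refine ⟨2 * (1 + K) * D, fun n hn => ⟨⟨hint n hsqn, ?_⟩, fun hs => ⟨hint n (hsq gstar), ?_⟩⟩⟩
  · calc _ ≤ ∫ ω, 2 * (1 + (K : ℝ)) * sqDist (saIterate c p α g0 (fun m => X m ω) n) h ∂P :=
          integral_mono (hint n hsqn) ((hint n (hsq h)).const_mul _) fun ω => by
            simp only [← hnorm]
            exact sqDist_normalizeFirst_le _ _
      _ = 2 * (1 + K) * ∫ ω, sqDist (saIterate c p α g0 (fun m => X m ω) n) h ∂P :=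
          integral_const_mul _ _
      _ ≤ 2 * (1 + K) * (D / n) := mul_le_mul_of_nonneg_left (hD n hn) (by positivity)
      _ = _ := by ring
  · have hhg : h = gstar := by
      funext i; simp [hh, hb, hs]
    rw [← hhg]
    refine (hD n hn).trans (div_le_div_of_nonneg_right ?_ (Nat.cast_nonneg n))
    nlinarith [Nat.cast_nonneg (α := ℝ) K, mul_nonneg (Nat.cast_nonneg (α := ℝ) K) hD0]
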